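/- **Definitions.** A parity automaton over an alphabet $\Pi$ with index $[\ell,h]$ ($\ell\le h$ natural numbers) has a set of states, a set of initial states, and transitions $(q,a,c,q')$ with $a\in\Pi$ and priority $c\in[\ell,h]$. It accepts an $\omega$-word $w\in\Pi^\omega$ if there is a run over $w$ from an initial state whose sequence of priorities has an even limit inferior. It is deterministic if it has exactly one initial state and for every state $q$ and letter $a$ there is exactly one pair $(c,q')$ such that $(q,a,c,q')$ is a transition. Let $(Q,\preceq)$ be a finite totally ordered set. For transitions in $Q\times\{0,1\}\times Q$ put $(p,c,q)\trianglelefteq(p',c',q')$ if $p\preceq p'$, $q'\preceq q$, and, in case $(p,q)=(p',q')$, $c\le c'$. An ordered Büchi automaton $\mathcal A=(Q,\preceq,I,\Gamma)$ consists of a downwards closed set $I\subseteq Q$ and a set $\Gamma$ of tiles, i.e. subsets of $Q\times\{0,1\}\times Q$, each upwards closed for $\trianglelefteq$. It is regarded as the parity automaton of index $[0,1]$ over the alphabet $\Gamma$ with initial states $I$ and with transitions $(p,t,c,q)$ for $t\in\Gamma$ and $(p,c,q)\in t$. Its language is denoted $L(\mathcal A)\subseteq\Gamma^\omega$. A record over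 $Q$ is a (possibly empty) tuple of pairwise distinct states whose entries form a downwards closed subset of $Q$ and whose first entry (if any) is the largest one. **Theorem.** There is a computable function which, given a finite description (lists of initial states and of transitions, with states, in increasing order, and letters numbered) of an ordered Büchi automaton $\mathcal A=(Q,\preceq,I,\Gamma)$, returns a finite description of a deterministic parity automaton $\mathcal D$ over $\Gamma$ such that 1. $L(\mathcal D)=L(\mathcal A)$; 2. $\mathcal D$ has at most $1+\sum_{i=0}^{|Q|-1} i!$ states; 3. the states of $\mathcal D$ are records over $Q$, and for every finite word $u\in\Gamma^*$ the entries of the record that $\mathcal D$ reaches after reading $u$ are exactly the states that $\mathcal A$ can reach from $I$ by reading $u$. -/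

import Mathlib

/-- A sequence of priorities is parity accepting (min-parity condition) if its limit inferior is
even. It is only applied to bounded sequences. -/
def ParityAccepting (c : ℕ → ℕ) : Prop :=
  Even (Filter.liminf c Filter.atTop)

/-- A (nondeterministic) parity automaton over the alphabet `Al` with set of states `Q`, with
priorities in the index `[lo, hi]`. A transition is a tuple (source, letter, priority, target). -/
structure ParityAutomaton (Al Q : Type*) where
  lo : ℕ
  hi : ℕ
  lo_le_hi : lo ≤ hi
  initial : Set Q
  trans : Set (Q × Al × ℕ × Q)
  priority_mem : ∀ d ∈ trans, lo ≤ d.2.2.1 ∧ d.2.2.1 ≤ hi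

namespace ParityAutomaton

/-- The `ω`-words over `Al` that admit an accepting run. -/
def language {Al Q : Type*} (A : ParityAutomaton Al Q) : Set (ℕ → Al) :=
  {w | ∃ (q : ℕ → Q) (c : ℕ → ℕ), q 0 ∈ A.initial ∧
    (∀ i, (q i, w i, c i, q (i + 1)) ∈ A.trans) ∧ ParityAccepting c}

/-- There is a single initial state, and the transition relation is the graph of a total function
from (state, letter) to (priority, state). -/
def IsDeterministic {Al Q : Type*} (A : ParityAutomaton Al Q) : Prop :=
  (∃ q, A.initial = {q}) ∧
    ∀ (q : Q) (a : Al), ∃! x : ℕ × Q, (q, a, x.1, x.2) ∈ A.trans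

/-- The states that can be reached from an initial state by reading the finite word `u`. -/
def reach {Al Q : Type*} (A : ParityAutomaton Al Q) (u : List Al) : Set Q :=
  u.foldl (fun X a => {q' | ∃ q ∈ X, ∃ c, (q, a, c, q') ∈ A.trans}) A.initial

end ParityAutomaton

/-- A Büchi tile over `Q`: a set of transitions `(p, c, q)`, where `c = 0` marks the Büchi
transitions. -/
abbrev Tile (Q : Type*) := Set (Q × Fin 2 × Q)

/-- The order on transitions induced by the order on states:
`(p, c, q)` is below `(p', c', q')` if `p ≤ p'`, `q' ≤ q`, and `c ≤ c'` in case
`(p, q) = (p', q')`. -/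
def TransLE {Q : Type*} [LinearOrder Q] (d d' : Q × Fin 2 × Q) : Prop :=
  d.1 ≤ d'.1 ∧ d'.2.2 ≤ d.2.2 ∧ ((d.1, d.2.2) = (d'.1, d'.2.2) → d.2.1 ≤ d'.2.1)

/-- The tile `t` is upwards closed for `TransLE`. -/
def Tile.IsUpClosed {Q : Type*} [LinearOrder Q] (t : Tile Q) : Prop :=
  ∀ d d' : Q × Fin 2 × Q, TransLE d d' → d ∈ t → d' ∈ t

/-- An ordered Büchi automaton on the totally ordered set of states `Q`. Its alphabet is the set
`tiles`, each letter being the set of transitions that it allows. -/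
structure OrderedBuchi (Q : Type*) [LinearOrder Q] where
  initial : Set Q
  tiles : Set (Tile Q)
  initial_lower : IsLowerSet initial
  tiles_upClosed : ∀ t ∈ tiles, Tile.IsUpClosed t

/-- The ordered Büchi automaton as a parity automaton with index `[0, 1]` over its alphabet of
tiles. -/
def OrderedBuchi.toParity {Q : Type*} [LinearOrder Q] (A : OrderedBuchi Q) :
    ParityAutomaton A.tiles Q where
  lo := 0
  hi := 1
  lo_le_hi := Nat.zero_le 1
  initial := A.initial
  trans := {d | ∃ c : Fin 2, d.2.2.1 = (c : ℕ) ∧ (d.1, c, d.2.2.2) ∈ (d.2.1 : Tile Q)}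
  priority_mem := by
    rintro d ⟨c, hc, -⟩
    have := c.isLt
    omega

/-- A record over `Q`: a (possibly empty) tuple of pairwise distinct states whose entries form a
downwards closed set, and whose first entry is the largest one. -/
structure Record (Q : Type*) [LinearOrder Q] where
  toList : List Q
  nodup : toList.Nodup
  lower : IsLowerSet {q | q ∈ toList}
  head_max : ∀ m ∈ toList.head?, ∀ q ∈ toList, q ≤ m

/-- Finite data that describe a finite parity automaton: numbers of letters and of states, the
bounds of the index, the list of initial states and the list of transitions
(source, letter, priority, target), states and letters being given by their numbers. -/
structure AutCode where
  numLetters : ℕ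
  numStates : ℕ
  lo : ℕ
  hi : ℕ
  initial : List ℕ
  trans : List (ℕ × ℕ × ℕ × ℕ)

/-- An automaton description as a tuple of its components. -/
def AutCode.equivProd :
    AutCode ≃ ℕ × ℕ × ℕ × ℕ × List ℕ × List (ℕ × ℕ × ℕ × ℕ) where
  toFun c := (c.numLetters, c.numStates, c.lo, c.hi, c.initial, c.trans)
  invFun x := ⟨x.1, x.2.1, x.2.2.1, x.2.2.2.1, x.2.2.2.2.1, x.2.2.2.2.2⟩
  left_inv _ := rfl
  right_inv _ := rfl

instance : Primcodable AutCode := Primcodable.ofEquiv _ AutCode.equivProd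

/-- The data `C` describe the automaton `A`, when its letters are numbered by `l` and its states
by `e`. -/
def AutCode.Describes (C : AutCode) {Al Q : Type*} {m n : ℕ} (A : ParityAutomaton Al Q)
    (l : Al ≃ Fin m) (e : Q ≃ Fin n) : Prop :=
  C.numLetters = m ∧ C.numStates = n ∧ C.lo = A.lo ∧ C.hi = A.hi ∧
    (∀ x : ℕ, x ∈ C.initial ↔ ∃ q ∈ A.initial, x = e q) ∧
    (∀ x : ℕ × ℕ × ℕ × ℕ, x ∈ C.trans ↔
      ∃ d ∈ A.trans, x = ((e d.1 : ℕ), (l d.2.1 : ℕ), d.2.2.1, (e d.2.2.2 : ℕ)))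

/-! Since a tile is upwards closed, a target below the largest target of `p` is reached by a Büchi
transition. So the tile is given by two maps: `f p`, the largest target shifted by one, and `g p`,
whether the transition to it is Büchi. Moreover `f` is monotone, and if `p < p'` share their largest
target, then `g p'` holds (`IsTileMap`). Reachable sets stay downwards closed, so a record is an
ordering of the reachable set with its maximum in front.

In a step every entry moves to its largest target. Losing the entry at position `j`, because it has
no target or its target is taken by an earlier entry, signals `2j+1`; a surviving entry that makes a
Büchi transition signals `2j+2`; the least signal is the priority. New states go to the end, so
entries only move to the left.

If the limit inferior is `2j+2`, then position `j` finally carries a run with infinitely many Büchi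
transitions; before that, the first entries form a prefix leading to it, the first entry being the
largest (`exists_isBuchiRun`).

If it is `2k+1`, the first `k` positions finally carry threads without Büchi transitions, and a
state strictly below a thread stays strictly below: merging would make the thread Büchi. For any
run, the set of threads strictly above it hence grows and becomes constant. The greedy run that
starts from there keeps below these threads and drifts to the left in the record until it is one of
the `k` threads. The given run must then lie on that thread forever, so it sees only finitely many
Büchi transitions (`not_isBuchiRun`).

All of this is primitive recursive on descriptions (`primrec_determinize`), and `Describes` carries
it over to the actual automata. -/

/-! ### The update of a record and its priority -/

/-- One step of the left-to-right scan of a record. The state of the scan consists of the current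
position, the entries kept so far and the least priority seen so far. `f p` is the successor of
the largest target of `p` (or `0` if there is none) and `g p` tells whether the transition from `p`
to this target is a Büchi transition. -/
def scanStep (f : ℕ → ℕ) (g : ℕ → Bool) (s : ℕ × List ℕ × ℕ) (p : ℕ) : ℕ × List ℕ × ℕ :=
  if f p = 0 ∨ f p - 1 ∈ s.2.1 then (s.1 + 1, s.2.1, min s.2.2 (2 * s.1 + 1))
  else (s.1 + 1, s.2.1 ++ [f p - 1], if g p then min s.2.2 (2 * s.1 + 2) else s.2.2)

/-- The scan of the record `r`, with default priority `2 * n + 1`. -/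
def scan (f : ℕ → ℕ) (g : ℕ → Bool) (n : ℕ) (r : List ℕ) : ℕ × List ℕ × ℕ :=
  r.foldl (scanStep f g) (0, [], 2 * n + 1)

/-- The record following `r`, and the priority of the transition: the entries of `r` move to
their largest targets, an entry is removed if there is none or if it is taken by an earlier entry,
and the missing states are appended. -/
def recordStep (f : ℕ → ℕ) (g : ℕ → Bool) (n : ℕ) (r : List ℕ) : List ℕ × ℕ :=
  ((scan f g n r).2.1 ++
    (List.range (scan f g n r).2.1.headI).reverse.filter (fun q => ¬ q ∈ (scan f g n r).2.1),
    (scan f g n r).2.2)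

/-- What the scan of `r` yields: the kept entries `out` and the priority `c`. -/
structure ScanSpec (f : ℕ → ℕ) (g : ℕ → Bool) (n : ℕ) (r out : List ℕ) (c : ℕ) : Prop where
  len_le : out.length ≤ r.length
  prio : c ≤ 2 * r.length ∨ (c = 2 * n + 1 ∧ out.length = r.length)
  prio_pos : 1 ≤ c
  prio_le : c ≤ 2 * n + 1
  nodup : out.Nodup
  mem : ∀ q ∈ out, ∃ p ∈ r, f p = q + 1
  follow : ∀ j p : ℕ, r[j]? = some p → f p ≠ 0 → ∃ j' ≤ j, out[j']? = some (f p - 1)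
  follow_lt : ∀ k j p : ℕ, c = 2 * k + 1 → k ≤ j → r[j]? = some p → f p ≠ 0 →
    ∃ j' < j, out[j']? = some (f p - 1)
  len_lt : ∀ k, c = 2 * k + 1 → k < r.length → out.length < r.length
  stay : ∀ j p : ℕ, r[j]? = some p → 2 * j + 2 ≤ c → f p ≠ 0 ∧ out[j]? = some (f p - 1)
  good : ∀ j, c = 2 * j + 2 → ∃ p, r[j]? = some p ∧ g p
  not_good : ∀ j p : ℕ, r[j]? = some p → 2 * j + 2 < c → ¬ g p

theorem scan_append (f : ℕ → ℕ) (g : ℕ → Bool) (n : ℕ) (r : List ℕ) (p : ℕ) :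
    scan f g n (r ++ [p]) = scanStep f g (scan f g n r) p := by
  simp [scan, List.foldl_append]

theorem scan_fst (f : ℕ → ℕ) (g : ℕ → Bool) (n : ℕ) (r : List ℕ) :
    (scan f g n r).1 = r.length := by
  induction r using List.reverseRecOn with
  | nil => rfl
  | append_singleton r p ih =>
    rw [scan_append, scanStep]
    split <;> simp [ih]

/-- Losing the entry at position `r.length` makes the output strictly shorter than the input, and
this persists. Hence the lost entry, if it has a target, and all later ones end strictly to the left
of where they were. -/
theorem ScanSpec.skip {f : ℕ → ℕ} {g : ℕ → Bool} {n : ℕ} {r out : List ℕ} {c p : ℕ}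
    (h : ScanSpec f g n r out c) (hp : f p = 0 ∨ f p - 1 ∈ out) :
    ScanSpec f g n (r ++ [p]) out (min c (2 * r.length + 1)) := by
  have key : f p ≠ 0 → ∃ j' < r.length, out[j']? = some (f p - 1) := by
    intro h0
    obtain ⟨j', hj', he⟩ := List.getElem_of_mem (hp.resolve_left h0)
    exact ⟨j', hj'.trans_le h.len_le, by rw [List.getElem?_eq_getElem hj', he]⟩
  have hlen : (r ++ [p]).length = r.length + 1 := by simp
  have hget : ∀ j q : ℕ, (r ++ [p])[j]? = some q → r[j]? = some q ∧ j < r.length ∨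
      j = r.length ∧ q = p := by
    intro j q hj
    grind
  have hlt := h.len_le
  have hpr := h.prio
  refine ⟨by omega, by omega, ?_, ?_, h.nodup, ?_, ?_, ?_, by omega, ?_, ?_, ?_⟩
  · have := h.prio_pos; omega
  · have := h.prio_le; omega
  · intro q hq
    obtain ⟨p', hp', he⟩ := h.mem q hq
    exact ⟨p', by simp [hp'], he⟩
  · intro j q hj h0
    rcases hget j q hj with ⟨hj, -⟩ | ⟨rfl, rfl⟩
    · exact h.follow j q hj h0
    · obtain ⟨j', hj', he⟩ := key h0
      exact ⟨j', hj'.le, he⟩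
  · intro k j q hc hk hj h0
    rcases hget j q hj with ⟨hj, hjl⟩ | ⟨rfl, rfl⟩
    · exact h.follow_lt k j q (by omega) hk hj h0
    · exact key h0
  · intro j q hj hc
    rcases hget j q hj with ⟨hj, hjl⟩ | ⟨rfl, rfl⟩
    · exact h.stay j q hj (by omega)
    · exfalso; clear key; omega
  · intro j hc
    obtain ⟨q, hq, hg⟩ := h.good j (by omega)
    refine ⟨q, ?_, hg⟩
    grind
  · intro j q hj hc
    rcases hget j q hj with ⟨hj, hjl⟩ | ⟨rfl, rfl⟩
    · exact h.not_good j q hj (by omega)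
    · omega

theorem ScanSpec.keep {f : ℕ → ℕ} {g : ℕ → Bool} {n : ℕ} {r out : List ℕ} {c p : ℕ}
    (h : ScanSpec f g n r out c) (hr : r.length < n) (hp : f p ≠ 0) (hp' : f p - 1 ∉ out) :
    ScanSpec f g n (r ++ [p]) (out ++ [f p - 1])
      (if g p then min c (2 * r.length + 2) else c) := by
  have hlen : (r ++ [p]).length = r.length + 1 := by simp
  have hlen' : (out ++ [f p - 1]).length = out.length + 1 := by simp
  have hget : ∀ j q : ℕ, (r ++ [p])[j]? = some q → r[j]? = some q ∧ j < r.length ∨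
      j = r.length ∧ q = p := by
    intro j q hj
    grind
  have hout : ∀ j q : ℕ, out[j]? = some q → (out ++ [f p - 1])[j]? = some q := by
    intro j q hj
    grind
  have hlast : (out ++ [f p - 1])[out.length]? = some (f p - 1) := by simp
  have hlt := h.len_le
  have hpr := h.prio
  have hpos := h.prio_pos
  have hple := h.prio_le
  set c' := if g p then min c (2 * r.length + 2) else c with hc'
  -- A priority other than the default is already at most `2 * r.length`, so a Büchi transition at
  -- the new position matters only if nothing was signalled before.
  have hcc : c' = c ∨ (g p ∧ c' = 2 * r.length + 2 ∧ c = 2 * n + 1) := by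
    by_cases hg : g p
    · simp only [hg, if_true] at hc'
      rcases hpr with h1 | h1
      · left; omega
      · right; exact ⟨hg, by omega, h1.1⟩
    · simp only [hg] at hc'
      exact Or.inl hc'
  refine ⟨by omega, by omega, by omega, by omega, ?_, ?_, ?_, ?_, ?_, ?_, ?_, ?_⟩
  · rw [List.nodup_append]
    refine ⟨h.nodup, by simp, ?_⟩
    intro a ha b hb
    rw [List.mem_singleton] at hb
    rintro rfl
    exact hp' (hb ▸ ha)
  · intro q hq
    rw [List.mem_append, List.mem_singleton] at hq
    rcases hq with hq | hq
    · obtain ⟨p', hp', he⟩ := h.mem q hq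
      exact ⟨p', by simp [hp'], he⟩
    · exact ⟨p, by simp, by omega⟩
  · intro j q hj h0
    rcases hget j q hj with ⟨hj, -⟩ | ⟨rfl, rfl⟩
    · obtain ⟨j', hj', he⟩ := h.follow j q hj h0
      exact ⟨j', hj', hout _ _ he⟩
    · exact ⟨_, hlt, hlast⟩
  · intro k j q hc hk hj h0
    have hc2 : c = 2 * k + 1 := by omega
    rcases hget j q hj with ⟨hj, hjl⟩ | ⟨rfl, rfl⟩
    · obtain ⟨j', hj', he⟩ := h.follow_lt k j q hc2 hk hj h0
      exact ⟨j', hj', hout _ _ he⟩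
    · exact ⟨_, h.len_lt k hc2 (by omega), hlast⟩
  · intro k hc hk
    have := h.len_lt k (by omega) (by omega)
    omega
  · intro j q hj hc
    rcases hget j q hj with ⟨hj, hjl⟩ | ⟨rfl, rfl⟩
    · obtain ⟨h1, h2⟩ := h.stay j q hj (by omega)
      exact ⟨h1, hout _ _ h2⟩
    · refine ⟨hp, ?_⟩
      have : out.length = r.length := by omega
      rw [← this]
      exact hlast
  · intro j hc
    rcases hcc with hcc | ⟨hg, hcc, -⟩
    · obtain ⟨q, hq, hg⟩ := h.good j (by omega)
      refine ⟨q, ?_, hg⟩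
      grind
    · refine ⟨p, ?_, hg⟩
      have : j = r.length := by omega
      subst this
      simp
  · intro j q hj hc
    rcases hget j q hj with ⟨hj, hjl⟩ | ⟨rfl, rfl⟩
    · exact h.not_good j q hj (by omega)
    · intro hg
      simp only [hg, if_true] at hc'
      omega

theorem scan_spec (f : ℕ → ℕ) (g : ℕ → Bool) (n : ℕ) (r : List ℕ) (hr : r.length ≤ n) :
    ScanSpec f g n r (scan f g n r).2.1 (scan f g n r).2.2 := by
  induction r using List.reverseRecOn with
  | nil => constructor <;> (simp [scan]; try omega)
  | append_singleton r p ih =>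
    have hr' : r.length < n := by simpa using hr
    have h := ih hr'.le
    rw [scan_append, scanStep, scan_fst]
    split
    · next hp => exact h.skip hp
    · next hp =>
      rw [not_or] at hp
      exact h.keep hr' hp.1 hp.2

/-! ### Records and tiles in terms of numbers -/

/-- Lists of numbered states that represent records. -/
def IsRecordList (n : ℕ) (r : List ℕ) : Prop :=
  r = [] ∨ ∃ m < n, ∃ t, r = m :: t ∧ t.Perm (List.range m)

theorem IsRecordList.length_le {n : ℕ} {r : List ℕ} (h : IsRecordList n r) : r.length ≤ n := by
  rcases h with rfl | ⟨m, hm, t, rfl, ht⟩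
  · simp
  · have := ht.length_eq
    simp only [List.length_range] at this
    simp only [List.length_cons]
    omega

theorem IsRecordList.lt {n : ℕ} {r : List ℕ} (h : IsRecordList n r) {p : ℕ} (hp : p ∈ r) :
    p < n := by
  rcases h with rfl | ⟨m, hm, t, rfl, ht⟩
  · simp at hp
  · rw [List.mem_cons, ht.mem_iff, List.mem_range] at hp
    omega

theorem IsRecordList.mem_iff {n m : ℕ} {t : List ℕ} (h : IsRecordList n (m :: t)) {p : ℕ} :
    p ∈ m :: t ↔ p ≤ m := by
  rcases h with h | ⟨m', hm, t', he, ht⟩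
  · simp at h
  · obtain ⟨rfl, rfl⟩ := List.cons.inj he
    rw [List.mem_cons, ht.mem_iff, List.mem_range]
    omega

theorem IsRecordList.nodup {n : ℕ} {r : List ℕ} (h : IsRecordList n r) : r.Nodup := by
  rcases h with rfl | ⟨m, hm, t, rfl, ht⟩
  · simp
  · rw [List.nodup_cons, ht.mem_iff, ht.nodup_iff]
    exact ⟨by simp, List.nodup_range⟩

/-- The conditions on the maps `f` and `g` (see `scanStep`) that come from a tile that is upwards
closed. -/
structure IsTileMap (n : ℕ) (f : ℕ → ℕ) (g : ℕ → Bool) : Prop where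
  mono : ∀ p p', p ≤ p' → p' < n → f p ≤ f p'
  le : ∀ p < n, f p ≤ n
  strict : ∀ p p', p < p' → p' < n → f p = f p' → f p' ≠ 0 → g p'

/-- What a step from `r` to `r'` with priority `c` does. -/
structure StepSpec (f : ℕ → ℕ) (g : ℕ → Bool) (n : ℕ) (r r' : List ℕ) (c : ℕ) : Prop where
  isRecordList : IsRecordList n r'
  mem_iff : ∀ q, q ∈ r' ↔ ∃ p ∈ r, q < f p
  prio_pos : 1 ≤ c
  prio_le : c ≤ 2 * n + 1
  follow : ∀ j p : ℕ, r[j]? = some p → f p ≠ 0 → ∃ j' ≤ j, r'[j']? = some (f p - 1)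
  follow_lt : ∀ k j p : ℕ, c = 2 * k + 1 → k ≤ j → r[j]? = some p → f p ≠ 0 →
    ∃ j' < j, r'[j']? = some (f p - 1)
  stay : ∀ j p : ℕ, r[j]? = some p → 2 * j + 2 ≤ c → f p ≠ 0 ∧ r'[j]? = some (f p - 1)
  good : ∀ j, c = 2 * j + 2 → ∃ p, r[j]? = some p ∧ g p
  not_good : ∀ j p : ℕ, r[j]? = some p → 2 * j + 2 < c → ¬ g p

theorem recordStep_spec {f : ℕ → ℕ} {g : ℕ → Bool} {n : ℕ} {r : List ℕ} (ht : IsTileMap n f g)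
    (hr : IsRecordList n r) :
    StepSpec f g n r (recordStep f g n r).1 (recordStep f g n r).2 := by
  have h := scan_spec f g n r hr.length_le
  rw [recordStep]
  generalize (scan f g n r).2.1 = out at *
  generalize (scan f g n r).2.2 = c at *
  -- `headI` is `0` on the empty list, so nothing is appended when no entry is kept.
  set r' := out ++ (List.range out.headI).reverse.filter (fun q => ¬ q ∈ out) with hr'
  have hext : ∀ j q : ℕ, out[j]? = some q → r'[j]? = some q := by
    intro j q hj
    rw [hr', List.getElem?_append_left, hj]
    exact (List.getElem?_eq_some_iff.mp hj).1
  have main : IsRecordList n r' ∧ ∀ q, q ∈ r' ↔ ∃ p ∈ r, q < f p := by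
    rcases hr0 : r with _ | ⟨m, t⟩
    · have : out = [] := by
        have := h.len_le
        rw [hr0] at this
        simpa using this
      subst this
      simp [hr', IsRecordList, show (default : ℕ) = 0 from rfl]
    · rw [hr0] at hr
      have hmn : m < n := hr.lt (by simp)
      have hfm : ∀ p ∈ m :: t, f p ≤ f m := fun p hp => ht.mono p m (hr.mem_iff.mp hp) hmn
      by_cases h0 : f m = 0
      · have hout : out = [] := by
          rw [List.eq_nil_iff_forall_not_mem]
          intro q hq
          obtain ⟨p, hp, he⟩ := h.mem q hq
          have := hfm p (hr0 ▸ hp)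
          omega
        rw [hr', hout]
        refine ⟨Or.inl (by simp [show (default : ℕ) = 0 from rfl]), ?_⟩
        intro q
        simp only [List.headI, List.nil_append]
        constructor
        · intro hq
          simp [show (default : ℕ) = 0 from rfl] at hq
        · rintro ⟨p, hp, hq⟩
          have := hfm p hp
          omega
      -- Entries only move to the left, so the first one stays first; by monotonicity of `f` its
      -- target is the new maximum.
      · obtain ⟨j', hj', he⟩ := h.follow 0 m (by simp [hr0]) h0
        obtain rfl : j' = 0 := by omega
        obtain ⟨t', rfl⟩ : ∃ t', out = (f m - 1) :: t' := by
          rcases out with _ | ⟨a, t'⟩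
          · simp at he
          · exact ⟨t', by simpa using he⟩
        have hmem : ∀ q, q ∈ r' ↔ q < f m := by
          intro q
          rw [hr', List.mem_append]
          constructor
          · rintro (hq | hq)
            · obtain ⟨p, hp, he⟩ := h.mem q hq
              have := hfm p (hr0 ▸ hp)
              omega
            · simp at hq
              omega
          · intro hq
            by_cases hq' : q ∈ (f m - 1) :: t'
            · exact Or.inl hq'
            · right
              simp only [List.mem_filter, List.mem_reverse, List.headI, List.mem_range]
              refine ⟨?_, by simpa using hq'⟩
              simp only [List.mem_cons, not_or] at hq'
              omega
        have hnd : r'.Nodup := by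
          rw [hr', List.nodup_append]
          refine ⟨h.nodup, (List.nodup_reverse.mpr List.nodup_range).filter _, ?_⟩
          rintro a ha b hb rfl
          rw [List.mem_filter] at hb
          simp only [decide_eq_true_eq] at hb
          exact hb.2 ha
        refine ⟨Or.inr ⟨f m - 1, ?_, _, by rw [hr', List.cons_append], ?_⟩, ?_⟩
        · have := ht.le m hmn
          omega
        · rw [hr', List.cons_append, List.nodup_cons] at hnd
          rw [List.perm_ext_iff_of_nodup hnd.2 List.nodup_range]
          intro a
          have h1 := hmem a
          rw [hr', List.cons_append, List.mem_cons] at h1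
          rw [List.mem_range]
          constructor
          · intro ha
            have h2 := h1.mp (Or.inr ha)
            have h3 : a ≠ f m - 1 := by
              rintro rfl
              exact hnd.1 ha
            omega
          · intro ha
            exact (h1.mpr (by omega)).resolve_left (by omega)
        · intro q
          rw [hmem]
          constructor
          · intro hq
            exact ⟨m, by simp, hq⟩
          · rintro ⟨p, hp, hq⟩
            exact hq.trans_le (hfm p hp)
  refine ⟨main.1, main.2, h.prio_pos, h.prio_le, ?_, ?_, ?_, h.good, h.not_good⟩
  · intro j p hj h0
    obtain ⟨j', hj', he⟩ := h.follow j p hj h0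
    exact ⟨j', hj', hext _ _ he⟩
  · intro k j p hc hk hj h0
    obtain ⟨j', hj', he⟩ := h.follow_lt k j p hc hk hj h0
    exact ⟨j', hj', hext _ _ he⟩
  · intro j p hj hc
    obtain ⟨h1, h2⟩ := h.stay j p hj hc
    exact ⟨h1, hext _ _ h2⟩

/-! ### Limit inferior of a bounded sequence of natural numbers -/

theorem Nat.liminf_eq_of_eventually_le_of_frequently_eq {c : ℕ → ℕ} {v : ℕ}
    (h1 : ∀ᶠ i in Filter.atTop, v ≤ c i) (h2 : ∃ᶠ i in Filter.atTop, c i = v) :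
    Filter.liminf c Filter.atTop = v := by
  have : {a | ∀ᶠ i in Filter.atTop, a ≤ c i} = Set.Iic v := by
    ext a
    simp only [Set.mem_ofPred_eq, Set.mem_Iic]
    constructor
    · intro h
      obtain ⟨i, hi, hi'⟩ := (h2.and_eventually h).exists
      omega
    · intro h
      filter_upwards [h1] with i hi
      omega
  rw [Filter.liminf_eq, this, csSup_Iic]

theorem Nat.exists_eventually_le_frequently_eq {c : ℕ → ℕ} {b : ℕ} (hb : ∀ i, c i ≤ b) :
    ∃ v, (∀ᶠ i in Filter.atTop, v ≤ c i) ∧ ∃ᶠ i in Filter.atTop, c i = v := by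
  classical
  have hex : ∃ v, ∃ᶠ i in Filter.atTop, c i ≤ v :=
    ⟨b, Filter.Frequently.of_forall hb⟩
  have h1 : ∀ᶠ i in Filter.atTop, Nat.find hex ≤ c i := by
    by_cases h0 : Nat.find hex = 0
    · simp [h0]
    · have := Nat.find_min hex (m := Nat.find hex - 1) (by omega)
      rw [Filter.not_frequently] at this
      filter_upwards [this] with i hi
      omega
  refine ⟨Nat.find hex, h1, ?_⟩
  refine ((Nat.find_spec hex).and_eventually h1).mono ?_
  rintro i ⟨h, h'⟩
  exact le_antisymm h h'

/-! ### The parity condition along a sequence of records -/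

/-- `ρ` is a run of the Büchi automaton that sees infinitely many Büchi transitions, the tiles
being given by the maps `f i` and `g i`. -/
def IsBuchiRun (f : ℕ → ℕ → ℕ) (g : ℕ → ℕ → Bool) (r : List ℕ) (ρ : ℕ → ℕ) : Prop :=
  ρ 0 ∈ r ∧ (∀ i, ρ (i + 1) < f i (ρ i)) ∧
    ∃ᶠ i in Filter.atTop, ρ (i + 1) + 1 < f i (ρ i) ∨ (ρ (i + 1) + 1 = f i (ρ i) ∧ g i (ρ i))

/-- `r` and `c` are the sequences of records and of priorities of the deterministic automaton. -/
structure IsRecordRun (n : ℕ) (f : ℕ → ℕ → ℕ) (g : ℕ → ℕ → Bool) (r : ℕ → List ℕ) (c : ℕ → ℕ) :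
    Prop where
  tile : ∀ i, IsTileMap n (f i) (g i)
  record : ∀ i, IsRecordList n (r i)
  step : ∀ i, StepSpec (f i) (g i) n (r i) (r (i + 1)) (c i)

namespace IsRecordRun

variable {n : ℕ} {f : ℕ → ℕ → ℕ} {g : ℕ → ℕ → Bool} {r : ℕ → List ℕ} {c : ℕ → ℕ}

theorem exists_isBuchiRun (h : IsRecordRun n f g r c) {j : ℕ}
    (h1 : ∀ᶠ i in Filter.atTop, 2 * j + 2 ≤ c i)
    (h2 : ∃ᶠ i in Filter.atTop, c i = 2 * j + 2) : ∃ ρ, IsBuchiRun f g (r 0) ρ := by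
  obtain ⟨N, hN⟩ := Filter.eventually_atTop.mp h1
  obtain ⟨i₀, hi₀, hc₀⟩ := Filter.frequently_atTop.mp h2 N
  have htail : ∀ i, i₀ ≤ i → ∃ p, (r i)[j]? = some p := by
    intro i hi
    induction i, hi using Nat.le_induction with
    | base =>
      obtain ⟨p, hp, -⟩ := (h.step i₀).good j hc₀
      exact ⟨p, hp⟩
    | succ i hi ih =>
      obtain ⟨p, hp⟩ := ih
      exact ⟨_, ((h.step i).stay j p hp (hN i (by omega))).2⟩
  have hhead : ∀ i, r (i + 1) ≠ [] → ∃ p t, r i = p :: t ∧ ∀ q ∈ r (i + 1), q < f i p := by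
    intro i hi
    obtain ⟨q, hq⟩ := List.exists_mem_of_ne_nil _ hi
    obtain ⟨p, hp, hqp⟩ := ((h.step i).mem_iff q).mp hq
    rcases hr : r i with _ | ⟨m, t⟩
    · simp [hr] at hp
    · refine ⟨m, t, rfl, ?_⟩
      intro q' hq'
      obtain ⟨p', hp', hqp'⟩ := ((h.step i).mem_iff q').mp hq'
      have hrec := h.record i
      rw [hr] at hp' hrec
      exact hqp'.trans_le ((h.tile i).mono p' m (hrec.mem_iff.mp hp') (hrec.lt (by simp)))
  -- Nonemptiness goes backwards from `i₀`: every entry of a record has a predecessor in the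
  -- previous one.
  have hne : ∀ i, r i ≠ [] := by
    have h' : ∀ d i, i + d = i₀ → r i ≠ [] := by
      intro d
      induction d with
      | zero =>
        rintro i rfl
        obtain ⟨p, hp⟩ := htail _ le_rfl
        rintro h0
        simp [h0] at hp
      | succ d ih =>
        intro i hi
        obtain ⟨p, t, hp, -⟩ := hhead i (ih (i + 1) (by omega))
        simp [hp]
    intro i
    by_cases hi : i ≤ i₀
    · exact h' (i₀ - i) i (by omega)
    · obtain ⟨p, hp⟩ := htail i (by omega)
      rintro h0
      simp [h0] at hp
  -- The run uses the first entry before `i₀` and position `j` from `i₀` on. The switch is possible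
  -- because the first entry reaches every state of the next record.
  have hpt : ∀ i, ∃ p, (i < i₀ → ∃ t, r i = p :: t) ∧ (i₀ ≤ i → (r i)[j]? = some p) := by
    intro i
    by_cases hi : i < i₀
    · obtain ⟨p, t, hp, -⟩ := hhead i (hne _)
      exact ⟨p, fun _ => ⟨t, hp⟩, fun _ => by omega⟩
    · obtain ⟨p, hp⟩ := htail i (by omega)
      exact ⟨p, fun _ => by omega, fun _ => hp⟩
  choose ρ hρ hρ' using hpt
  have hmem : ∀ i, ρ i ∈ r i := by
    intro i
    by_cases hi : i < i₀
    · obtain ⟨t, ht⟩ := hρ i hi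
      rw [ht]
      simp
    · exact List.mem_of_getElem? (hρ' i (by omega))
  have hstay : ∀ i, i₀ ≤ i → ρ (i + 1) + 1 = f i (ρ i) := by
    intro i hi
    obtain ⟨h3, h4⟩ := (h.step i).stay j _ (hρ' i hi) (hN i (by omega))
    rw [hρ' (i + 1) (by omega)] at h4
    have := Option.some.inj h4
    omega
  refine ⟨ρ, hmem 0, ?_, ?_⟩
  · intro i
    by_cases hi : i < i₀
    · obtain ⟨t, ht⟩ := hρ i hi
      obtain ⟨p, t', hp, hq⟩ := hhead i (hne _)
      rw [ht] at hp
      rw [(List.cons.inj hp).1]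
      exact hq _ (hmem _)
    · have := hstay i (by omega)
      omega
  · refine (h2.and_eventually (Filter.eventually_ge_atTop i₀)).mono ?_
    rintro i ⟨hc, hi⟩
    obtain ⟨p, hp, hg⟩ := (h.step i).good j hc
    rw [hρ' i hi] at hp
    exact Or.inr ⟨hstay i hi, Option.some.inj hp ▸ hg⟩

theorem mem_of_isBuchiRun (h : IsRecordRun n f g r c) {ρ : ℕ → ℕ} (h0 : ρ 0 ∈ r 0)
    (hρ : ∀ i, ρ (i + 1) < f i (ρ i)) (i : ℕ) : ρ i ∈ r i := by
  induction i with
  | zero => exact h0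
  | succ i ih => exact ((h.step i).mem_iff _).mpr ⟨_, ih, hρ i⟩

/-- Following the largest targets, one comes to one of the first `k` entries of the record. -/
theorem exists_getElem?_lt (h : IsRecordRun n f g r c) {k : ℕ}
    (h2 : ∃ᶠ i in Filter.atTop, c i = 2 * k + 1) {o : ℕ → ℕ} {N : ℕ}
    (hf : ∀ i, N ≤ i → f i (o i) = o (i + 1) + 1) (d : ℕ) :
    ∀ i, N ≤ i → (r i)[d]? = some (o i) → ∃ M, N ≤ M ∧ ∃ j < k, (r M)[j]? = some (o M) := by
  induction d using Nat.strong_induction_on with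
  | _ d ih =>
    intro i hi hd
    obtain ⟨i', hi', hc⟩ := Filter.frequently_atTop.mp h2 i
    have hdesc : ∀ i', i ≤ i' → ∃ d' ≤ d, (r i')[d']? = some (o i') := by
      intro i' hi'
      induction i', hi' using Nat.le_induction with
      | base => exact ⟨d, le_rfl, hd⟩
      | succ i' hi' ih' =>
        obtain ⟨d', hd', he⟩ := ih'
        have hfo := hf i' (by omega)
        obtain ⟨d'', hd'', he'⟩ := (h.step i').follow d' _ he (by omega)
        rw [hfo, Nat.add_sub_cancel] at he'
        exact ⟨d'', by omega, he'⟩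
    obtain ⟨d', hd', he⟩ := hdesc i' hi'
    by_cases hk : d' < k
    · exact ⟨i', by omega, d', hk, he⟩
    -- From position `k` on, a step of priority `2k+1` moves the entry strictly to the left, so the
    -- induction hypothesis applies.
    · have hfo := hf i' (by omega)
      obtain ⟨d'', hd'', he'⟩ := (h.step i').follow_lt k d' _ hc (by omega) he (by omega)
      rw [hfo, Nat.add_sub_cancel] at he'
      exact ih d'' (by omega) (i' + 1) (by omega) he'

/-- A Büchi run would finally be confined to one of the first `k` threads, none of which makes a
Büchi transition any more. -/
theorem not_isBuchiRun (h : IsRecordRun n f g r c) {k : ℕ}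
    (h1 : ∀ᶠ i in Filter.atTop, 2 * k + 1 ≤ c i)
    (h2 : ∃ᶠ i in Filter.atTop, c i = 2 * k + 1) (ρ : ℕ → ℕ) :
    ¬ IsBuchiRun f g (r 0) ρ := by
  rintro ⟨h0, hρ, hbuchi⟩
  obtain ⟨N, hN⟩ := Filter.eventually_atTop.mp h1
  have hmem := h.mem_of_isBuchiRun h0 hρ
  have hthread : ∀ i j p, N ≤ i → j < k → (r i)[j]? = some p →
      f i p ≠ 0 ∧ (r (i + 1))[j]? = some (f i p - 1) ∧ ¬ g i p := by
    intro i j p hi hj hp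
    have hc := hN i hi
    obtain ⟨h3, h4⟩ := (h.step i).stay j p hp (by omega)
    exact ⟨h3, h4, (h.step i).not_good j p hp (by omega)⟩
  -- a state below a thread stays below it
  have hbelow : ∀ i j p q, N ≤ i → j < k → (r i)[j]? = some p → q < p → f i q < f i p := by
    intro i j p q hi hj hp hq
    have hpn : p < n := (h.record i).lt (List.mem_of_getElem? hp)
    obtain ⟨h3, -, h5⟩ := hthread i j p hi hj hp
    refine lt_of_le_of_ne ((h.tile i).mono q p hq.le hpn) ?_
    intro he
    exact h5 ((h.tile i).strict q p hq hpn he h3)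
  -- The threads strictly above the run. This set grows within a finite set, so it is constant from
  -- `K` on.
  let A : ℕ → Set (Fin k) := fun i => {j | ∃ p, (r (N + i))[(j : ℕ)]? = some p ∧ ρ (N + i) < p}
  have hA : Monotone A := by
    refine monotone_nat_of_le_succ ?_
    rintro i j ⟨p, hp, hlt⟩
    obtain ⟨h3, h4, h5⟩ := hthread _ _ p (by omega) j.2 hp
    refine ⟨_, h4, ?_⟩
    have h6 := hbelow _ _ _ _ (by omega) j.2 hp hlt
    have h7 := hρ (N + i)
    rw [← Nat.add_assoc]
    omega
  obtain ⟨K, hK⟩ := WellFoundedGT.monotone_chain_condition (⟨A, hA⟩ : ℕ →o Set (Fin k))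
  have hstab : ∀ i i' j p', N + K ≤ i → N + K ≤ i' → j < k → (r i')[j]? = some p' →
      ρ i' < p' → ∃ p, (r i)[j]? = some p ∧ ρ i < p := by
    intro i i' j p' hi hi' hj hp' hlt
    have h3 : A K = A (i - N) := hK (i - N) (by omega)
    have h3' : A K = A (i' - N) := hK (i' - N) (by omega)
    have h4 : (⟨j, hj⟩ : Fin k) ∈ A (i' - N) := by
      refine ⟨p', ?_⟩
      rw [show N + (i' - N) = i' by omega]
      exact ⟨hp', hlt⟩
    rw [← h3', h3] at h4
    obtain ⟨p'', hp'', hlt'⟩ := h4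
    rw [show N + (i - N) = i by omega] at hp'' hlt'
    exact ⟨p'', hp'', hlt'⟩
  -- the greedy continuation of the run
  let o' : ℕ → ℕ := fun d => Nat.rec (ρ (N + K)) (fun d x => f (N + K + d) x - 1) d
  let o : ℕ → ℕ := fun i => o' (i - (N + K))
  have ho0 : o (N + K) = ρ (N + K) := by simp [o, o']
  have hosucc : ∀ i, N + K ≤ i → o (i + 1) = f i (o i) - 1 := by
    intro i hi
    simp only [o, show i + 1 - (N + K) = (i - (N + K)) + 1 by omega]
    simp only [o', show N + K + (i - (N + K)) = i by omega]
  have hoge : ∀ i, N + K ≤ i → ρ i ≤ o i ∧ o i ∈ r i := by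
    intro i hi
    induction i, hi using Nat.le_induction with
    | base => exact ⟨ho0.ge, ho0 ▸ hmem _⟩
    | succ i hi ih =>
      have h3 := (h.tile i).mono _ _ ih.1 ((h.record i).lt ih.2)
      have h4 := hρ i
      rw [hosucc i hi]
      refine ⟨by omega, ((h.step i).mem_iff _).mpr ⟨_, ih.2, by omega⟩⟩
  have hof : ∀ i, N + K ≤ i → f i (o i) = o (i + 1) + 1 := by
    intro i hi
    have h3 := (h.tile i).mono _ _ (hoge i hi).1 ((h.record i).lt (hoge i hi).2)
    have h4 := hρ i
    rw [hosucc i hi]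
    omega
  have hobelow : ∀ i j p, N + K ≤ i → j < k → (r i)[j]? = some p → ρ i < p → o i < p := by
    intro i j p hi hj
    induction i, hi using Nat.le_induction generalizing p with
    | base =>
      rw [ho0]
      exact fun _ hlt => hlt
    | succ i hi ih =>
      intro hp hlt
      -- By stability, a thread above `ρ` at `i + 1` was already above it at `i`, where the
      -- induction hypothesis places it above `o` too.
      obtain ⟨p₀, hp₀, hlt₀⟩ := hstab i (i + 1) j p hi (by omega) hj hp hlt
      obtain ⟨h3, h4, -⟩ := hthread i j p₀ (by omega) hj hp₀
      have h5 := hbelow i j p₀ _ (by omega) hj hp₀ (ih p₀ hp₀ hlt₀)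
      rw [h4] at hp
      have h6 := Option.some.inj hp
      have h7 := hof i hi
      omega
  obtain ⟨d, hd, hde⟩ := List.getElem_of_mem (hoge _ le_rfl).2
  obtain ⟨M, hM, j, hj, hoM⟩ := h.exists_getElem?_lt h2 hof d (N + K) le_rfl
    (by rw [List.getElem?_eq_getElem hd, hde])
  -- If `ρ M` were smaller, thread `j` would be strictly above `ρ`, hence strictly above `o`, which
  -- lies on it.
  have hρM : ρ M = o M := by
    refine le_antisymm (hoge M hM).1 ?_
    by_contra hlt
    have := hobelow M j _ hM hj hoM (by omega)
    omega
  have hfin : ∀ i, M ≤ i → (r i)[j]? = some (ρ i) := by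
    intro i hi
    induction i, hi using Nat.le_induction with
    | base => rw [hρM, hoM]
    | succ i hi ih =>
      obtain ⟨h3, h4, h5⟩ := hthread i j _ (by omega) hj ih
      rw [h4]
      by_contra hne
      have h6 := hρ i
      have h7 : f i (ρ i) - 1 ≠ ρ (i + 1) := fun h' => hne (by rw [h'])
      -- Dropping below thread `j` would make it newly above the run, against stability.
      obtain ⟨p, hp, hlt⟩ := hstab i (i + 1) j _ (by omega) (by omega) hj h4 (by omega)
      rw [ih] at hp
      exact absurd (Option.some.inj hp) hlt.ne
  obtain ⟨i, hi, hor⟩ := Filter.frequently_atTop.mp hbuchi M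
  obtain ⟨h3, h4, h5⟩ := hthread i j _ (by omega) hj (hfin i hi)
  rw [hfin (i + 1) (by omega)] at h4
  have h6 := Option.some.inj h4
  rcases hor with hor | ⟨-, hg⟩
  · omega
  · exact h5 hg

/-- The priorities satisfy the parity condition if and only if there is an accepting run. -/
theorem parityAccepting_iff (h : IsRecordRun n f g r c) :
    ParityAccepting c ↔ ∃ ρ, IsBuchiRun f g (r 0) ρ := by
  obtain ⟨v, h1, h2⟩ := Nat.exists_eventually_le_frequently_eq (fun i => (h.step i).prio_le)
  rw [ParityAccepting, Nat.liminf_eq_of_eventually_le_of_frequently_eq h1 h2]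
  obtain ⟨i, hi⟩ := h2.exists
  have hpos := (h.step i).prio_pos
  rcases Nat.even_or_odd v with hv | hv
  -- Priorities are positive, so an even `v` is not `0`.
  · obtain ⟨j, rfl⟩ : ∃ j, v = 2 * j + 2 := by
      obtain ⟨j, hj⟩ := hv
      exact ⟨j - 1, by omega⟩
    exact ⟨fun _ => h.exists_isBuchiRun h1 h2, fun _ => hv⟩
  · obtain ⟨k, rfl⟩ := hv
    refine ⟨fun h' => absurd h' (by simp), ?_⟩
    rintro ⟨ρ, hρ⟩
    exact absurd hρ (h.not_isBuchiRun h1 h2 ρ)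

end IsRecordRun

/-! ### Enumeration of the records -/

/-- The records over `n` numbered states. -/
def recordLists (n : ℕ) : List (List ℕ) :=
  [] :: (List.range n).flatMap fun m => (List.range m).permutations'.map (List.cons m)

theorem mem_recordLists {n : ℕ} {r : List ℕ} : r ∈ recordLists n ↔ IsRecordList n r := by
  simp only [recordLists, IsRecordList, List.mem_cons, List.mem_flatMap, List.mem_range,
    List.mem_map, List.mem_permutations']
  grind

theorem nodup_permutations'_range (m : ℕ) : (List.range m).permutations'.Nodup := by
  exact (List.permutations_perm_permutations' _).nodup_iff.mp
    (List.nodup_permutations _ List.nodup_range)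

theorem nodup_recordLists (n : ℕ) : (recordLists n).Nodup := by
  rw [recordLists, List.nodup_cons, List.nodup_flatMap]
  refine ⟨by simp, fun m _ => (nodup_permutations'_range m).map (List.cons_injective), ?_⟩
  refine List.nodup_range.imp ?_
  intro a b hab
  simp only [Function.onFun, List.disjoint_left, List.mem_map]
  rintro _ ⟨t, -, rfl⟩ ⟨t', -, h⟩
  exact hab (List.cons.inj h).1.symm

theorem length_recordLists (n : ℕ) :
    (recordLists n).length = 1 + ∑ i ∈ Finset.range n, Nat.factorial i := by
  rw [recordLists, List.length_cons, List.length_flatMap, add_comm]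
  simp only [List.length_map, ← (List.permutations_perm_permutations' _).length_eq,
    List.length_permutations, List.length_range]
  rfl

/-! ### Determinization of descriptions -/

namespace AutCode

/-- The successor of the largest target of `p` on the letter `a`, or `0` if there is none. -/
def maxTarget (T : List (ℕ × ℕ × ℕ × ℕ)) (a p : ℕ) : ℕ :=
  T.foldl (fun x d => if d.1 = p ∧ d.2.1 = a then max x (d.2.2.2 + 1) else x) 0

/-- Whether the transition from `p` to its largest target is a Büchi transition. -/
def isBuchi (T : List (ℕ × ℕ × ℕ × ℕ)) (a p : ℕ) : Bool :=
  decide ((p, a, 0, maxTarget T a p - 1) ∈ T)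

/-- The record of all states that are at most as large as some state in `I`. -/
def initialRecord (I : List ℕ) : List ℕ :=
  (List.range (I.foldl (fun x q => max x (q + 1)) 0)).reverse

/-- The transition of the deterministic automaton. -/
def recordTrans (C : AutCode) (a : ℕ) (r : List ℕ) : List ℕ × ℕ :=
  recordStep (maxTarget C.trans a) (isBuchi C.trans a) C.numStates r

/-- The description of the deterministic automaton. -/
def determinize (C : AutCode) : AutCode where
  numLetters := C.numLetters
  numStates := (recordLists C.numStates).length
  lo := 0
  hi := 2 * C.numStates + 1
  initial := [(recordLists C.numStates).idxOf (initialRecord C.initial)]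
  trans := (recordLists C.numStates).flatMap fun r => (List.range C.numLetters).map fun a =>
    ((recordLists C.numStates).idxOf r, a, (C.recordTrans a r).2,
      (recordLists C.numStates).idxOf (C.recordTrans a r).1)

end AutCode

/-! ### Primitive recursiveness of the construction -/

section Primrec

open Primrec

theorem primrec_permutations'Aux : Primrec₂ (@List.permutations'Aux ℕ) := by
  have : Primrec₂ fun (t : ℕ) (l : List ℕ) => (List.rec [[t]]
      (fun y ys ih => (t :: y :: ys) :: ih.map (List.cons y)) l : List (List ℕ)) := by
    refine Primrec.list_rec snd (list_cons.comp (list_cons.comp fst (const [])) (const []))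
      (h := fun (x : ℕ × List ℕ) (z : ℕ × List ℕ × List (List ℕ)) =>
        (x.1 :: z.1 :: z.2.1) :: z.2.2.map (List.cons z.1)) ?_
    refine list_cons.comp (list_cons.comp (fst.comp fst)
      (list_cons.comp (fst.comp snd) (fst.comp (snd.comp snd)))) ?_
    exact list_map (snd.comp (snd.comp snd))
      (list_cons.comp (fst.comp (snd.comp fst)) snd)
  refine this.of_eq ?_
  intro t l
  induction l with
  | nil => rfl
  | cons y ys ih => simp only [List.permutations'Aux, ← ih]

theorem primrec_permutations' : Primrec (@List.permutations' ℕ) := by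
  have : Primrec fun (l : List ℕ) => (List.rec [[]]
      (fun t _ ih => ih.flatMap (List.permutations'Aux t)) l : List (List ℕ)) := by
    refine Primrec.list_rec .id (const [[]])
      (h := fun (_ : List ℕ) (z : ℕ × List ℕ × List (List ℕ)) =>
        z.2.2.flatMap (List.permutations'Aux z.1)) ?_
    exact list_flatMap (snd.comp (snd.comp snd))
      (primrec_permutations'Aux.comp (fst.comp (snd.comp fst)) snd)
  refine this.of_eq ?_
  intro l
  induction l with
  | nil => rfl
  | cons y ys ih => simp only [List.permutations', ← ih]

theorem primrec_recordLists : Primrec recordLists := by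
  refine list_cons.comp (const []) (list_flatMap list_range ?_)
  exact list_map (primrec_permutations'.comp (list_range.comp snd)) (list_cons.comp (snd.comp fst) snd)

variable {α : Type*} [Primcodable α]

theorem Primrec.list_mem {β : Type*} [Primcodable β] [DecidableEq β] {f : α → β} {l : α → List β}
    (hf : Primrec f) (hl : Primrec l) : PrimrecPred fun x => f x ∈ l x :=
  (nat_lt.comp (list_idxOf.comp hf hl) (list_length.comp hl)).of_eq
    fun _ => List.idxOf_lt_length_iff

/-- Boolean equality on lists need not be definitionally the one derived from decidable equality;
lawful instances agree. -/
theorem Primrec.list_idxOf_of_lawfulBEq {β : Type*} [Primcodable β] [BEq β] [LawfulBEq β]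
    {f : α → β} {l : α → List β} (hf : Primrec f) (hl : Primrec l) :
    Primrec fun x => (l x).idxOf (f x) := by
  classical
  refine (list_idxOf.comp hf hl).of_eq fun x => ?_
  congr 1
  exact lawful_beq_subsingleton _ _

theorem primrec_maxTarget {T : α → List (ℕ × ℕ × ℕ × ℕ)} {a p : α → ℕ} (hT : Primrec T)
    (ha : Primrec a) (hp : Primrec p) : Primrec fun x => AutCode.maxTarget (T x) (a x) (p x) := by
  refine list_foldl hT (const 0)
    (h := fun x (z : ℕ × ℕ × ℕ × ℕ × ℕ) =>
      if z.2.1 = p x ∧ z.2.2.1 = a x then max z.1 (z.2.2.2.2 + 1) else z.1) ?_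
  refine Primrec.ite (PrimrecPred.and (Primrec.eq.comp ?_ ?_) (Primrec.eq.comp ?_ ?_))
    (nat_max.comp ?_ (succ.comp ?_)) ?_
  · exact fst.comp (snd.comp snd)
  · exact hp.comp fst
  · exact fst.comp (snd.comp (snd.comp snd))
  · exact ha.comp fst
  · exact fst.comp snd
  · exact snd.comp (snd.comp (snd.comp (snd.comp snd)))
  · exact fst.comp snd

theorem primrec_isBuchi {T : α → List (ℕ × ℕ × ℕ × ℕ)} {a p : α → ℕ} (hT : Primrec T)
    (ha : Primrec a) (hp : Primrec p) :
    PrimrecPred fun x => AutCode.isBuchi (T x) (a x) (p x) = true := by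
  refine (Primrec.list_mem (f := fun x => (p x, a x, 0, AutCode.maxTarget (T x) (a x) (p x) - 1))
    ?_ hT).of_eq (fun x => by simp [AutCode.isBuchi])
  exact hp.pair (ha.pair ((const 0).pair (pred.comp (primrec_maxTarget hT ha hp))))

theorem primrec_scan {T : α → List (ℕ × ℕ × ℕ × ℕ)} {a n : α → ℕ} {r : α → List ℕ}
    (hT : Primrec T) (ha : Primrec a) (hn : Primrec n) (hr : Primrec r) :
    Primrec fun x => scan (AutCode.maxTarget (T x) (a x)) (AutCode.isBuchi (T x) (a x)) (n x)
      (r x) := by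
  have hprio : Primrec fun x => 2 * n x + 1 := succ.comp (nat_mul.comp (const 2) hn)
  refine list_foldl hr ((const 0).pair ((const []).pair hprio))
    (h := fun x (z : (ℕ × List ℕ × ℕ) × ℕ) =>
      scanStep (AutCode.maxTarget (T x) (a x)) (AutCode.isBuchi (T x) (a x)) z.1 z.2) ?_
  have hp : Primrec fun y : α × (ℕ × List ℕ × ℕ) × ℕ => y.2.2 := snd.comp snd
  have hi : Primrec fun y : α × (ℕ × List ℕ × ℕ) × ℕ => y.2.1.1 := fst.comp (fst.comp snd)
  have ho : Primrec fun y : α × (ℕ × List ℕ × ℕ) × ℕ => y.2.1.2.1 :=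
    fst.comp (snd.comp (fst.comp snd))
  have hc : Primrec fun y : α × (ℕ × List ℕ × ℕ) × ℕ => y.2.1.2.2 :=
    snd.comp (snd.comp (fst.comp snd))
  have hf := primrec_maxTarget (hT.comp fst) (ha.comp fst) hp
  have hg := primrec_isBuchi (hT.comp fst) (ha.comp fst) hp
  have hf' := pred.comp hf
  have hi2 := nat_mul.comp (const 2) hi
  refine Primrec.ite (PrimrecPred.or (Primrec.eq.comp hf (const 0)) (Primrec.list_mem hf' ho))
    ((succ.comp hi).pair (ho.pair (nat_min.comp hc (succ.comp hi2))))
    ((succ.comp hi).pair ((list_append.comp ho (list_cons.comp hf' (const []))).pair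
      (Primrec.ite hg (nat_min.comp hc (succ.comp (succ.comp hi2))) hc)))

theorem primrec_recordStep {T : α → List (ℕ × ℕ × ℕ × ℕ)} {a n : α → ℕ} {r : α → List ℕ}
    (hT : Primrec T) (ha : Primrec a) (hn : Primrec n) (hr : Primrec r) :
    Primrec fun x => recordStep (AutCode.maxTarget (T x) (a x)) (AutCode.isBuchi (T x) (a x))
      (n x) (r x) := by
  have hs := primrec_scan hT ha hn hr
  have ho := fst.comp (snd.comp hs)
  refine (list_append.comp ho ?_).pair (snd.comp (snd.comp hs))
  have hrel : PrimrecRel fun (q : ℕ) (l : List ℕ) => ¬ q ∈ l :=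
    PrimrecPred.not (Primrec.list_mem fst snd)
  exact hrel.listFilter.comp (list_reverse.comp (list_range.comp (list_headI.comp ho))) ho

theorem AutCode.primrec_equivProd : Primrec AutCode.equivProd := Primrec.of_equiv

theorem AutCode.primrec_determinize : Primrec AutCode.determinize := by
  have h : Primrec fun C : AutCode => AutCode.equivProd C := AutCode.primrec_equivProd
  have h1 : Primrec AutCode.numLetters := (fst.comp h).of_eq fun _ => rfl
  have h2 : Primrec AutCode.numStates := (fst.comp (snd.comp h)).of_eq fun _ => rfl
  have h' := snd.comp (snd.comp (snd.comp (snd.comp h)))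
  have h5 : Primrec AutCode.initial := (fst.comp h').of_eq fun _ => rfl
  have h6 : Primrec AutCode.trans := (snd.comp h').of_eq fun _ => rfl
  have hR := primrec_recordLists.comp h2
  have hI : Primrec fun C : AutCode => AutCode.initialRecord C.initial := by
    refine list_reverse.comp (list_range.comp (list_foldl h5 (const 0)
      (h := fun _ (z : ℕ × ℕ) => max z.1 (z.2 + 1)) ?_))
    exact nat_max.comp (fst.comp snd) (succ.comp (snd.comp snd))
  have hT : Primrec fun C : AutCode => (recordLists C.numStates).flatMap fun r =>
      (List.range C.numLetters).map fun a =>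
        ((recordLists C.numStates).idxOf r, a, (C.recordTrans a r).2,
          (recordLists C.numStates).idxOf (C.recordTrans a r).1) := by
    refine list_flatMap hR (list_map (list_range.comp (h1.comp fst)) ?_)
    have hC : Primrec fun y : (AutCode × List ℕ) × ℕ => y.1.1 := fst.comp fst
    have hr : Primrec fun y : (AutCode × List ℕ) × ℕ => y.1.2 := snd.comp fst
    have ha : Primrec fun y : (AutCode × List ℕ) × ℕ => y.2 := snd
    have hs : Primrec fun y : (AutCode × List ℕ) × ℕ => y.1.1.recordTrans y.2 y.1.2 :=
      primrec_recordStep (h6.comp hC) ha (h2.comp hC) hr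
    have hRC : Primrec fun y : (AutCode × List ℕ) × ℕ => recordLists y.1.1.numStates :=
      hR.comp hC
    have h7 : Primrec fun y : (AutCode × List ℕ) × ℕ =>
        (recordLists y.1.1.numStates).idxOf y.1.2 :=
      Primrec.list_idxOf_of_lawfulBEq hr hRC
    have h8 : Primrec fun y : (AutCode × List ℕ) × ℕ =>
        (recordLists y.1.1.numStates).idxOf (y.1.1.recordTrans y.2 y.1.2).1 :=
      Primrec.list_idxOf_of_lawfulBEq (fst.comp hs) hRC
    exact h7.pair (ha.pair ((snd.comp hs).pair h8))
  have h9 : Primrec fun C : AutCode =>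
      [(recordLists C.numStates).idxOf (AutCode.initialRecord C.initial)] :=
    list_cons.comp (Primrec.list_idxOf_of_lawfulBEq hI hR) (const [])
  have h10 : Primrec fun C : AutCode => 2 * C.numStates + 1 :=
    succ.comp (nat_mul.comp (const 2) h2)
  have h11 : Primrec fun C : AutCode => (recordLists C.numStates).length := list_length.comp hR
  exact (Primrec.of_equiv_iff AutCode.equivProd).mp
    (h1.pair (h11.pair ((const 0).pair (h10.pair (h9.pair hT)))))

end Primrec

/-! ### Acceptance, runs and maximal targets -/

theorem parityAccepting_iff_frequently_eq_zero {c : ℕ → ℕ} (hc : ∀ i, c i ≤ 1) :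
    ParityAccepting c ↔ ∃ᶠ i in Filter.atTop, c i = 0 := by
  obtain ⟨v, h1, h2⟩ := Nat.exists_eventually_le_frequently_eq hc
  rw [ParityAccepting, Nat.liminf_eq_of_eventually_le_of_frequently_eq h1 h2]
  obtain ⟨i, hi⟩ := h2.exists
  have hv : v ≤ 1 := hi ▸ hc i
  constructor
  · intro h
    obtain rfl : v = 0 := by
      obtain ⟨k, hk⟩ := h
      omega
    exact h2
  · intro h
    obtain ⟨i, hi, hi'⟩ := (h.and_eventually h1).exists
    obtain rfl : v = 0 := by omega
    exact Even.zero

namespace ParityAutomaton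

variable {Al Q : Type*}

theorem IsDeterministic.exists_run {D : ParityAutomaton Al Q} (hD : D.IsDeterministic)
    (w : ℕ → Al) : ∃ (q : ℕ → Q) (c : ℕ → ℕ), q 0 ∈ D.initial ∧
      ∀ i, (q i, w i, c i, q (i + 1)) ∈ D.trans := by
  obtain ⟨⟨q₀, h₀⟩, hstep⟩ := hD
  choose δ hδ using fun q a => (hstep q a).exists
  let q : ℕ → Q := fun i => Nat.rec q₀ (fun i x => (δ x (w i)).2) i
  exact ⟨q, fun i => (δ (q i) (w i)).1, by simp [q, h₀], fun i => hδ (q i) (w i)⟩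

theorem reach_append_singleton (A : ParityAutomaton Al Q) (u : List Al) (a : Al) :
    A.reach (u ++ [a]) = {q' | ∃ q ∈ A.reach u, ∃ c, (q, a, c, q') ∈ A.trans} := by
  simp [reach, List.foldl_append]

end ParityAutomaton

namespace AutCode

theorem lt_maxTarget_iff {T : List (ℕ × ℕ × ℕ × ℕ)} {a p q : ℕ} :
    q < maxTarget T a p ↔ ∃ c q', (p, a, c, q') ∈ T ∧ q ≤ q' := by
  -- The induction needs an arbitrary start value of the fold.
  have h : ∀ x, q < T.foldl (fun x d => if d.1 = p ∧ d.2.1 = a then max x (d.2.2.2 + 1) else x) x ↔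
      q < x ∨ ∃ c q', (p, a, c, q') ∈ T ∧ q ≤ q' := by
    induction T with
    | nil => simp
    | cons d T ih =>
      obtain ⟨p', a', c', q'⟩ := d
      intro x
      rw [List.foldl_cons, ih]
      by_cases hd : p' = p ∧ a' = a
      · obtain ⟨rfl, rfl⟩ := hd
        clear ih
        simp only [and_self, if_true, List.mem_cons, Prod.mk.injEq, true_and, lt_max_iff,
          Nat.lt_succ_iff, or_and_right, exists_or, or_assoc]
        rw [show (∃ c q'', (c = c' ∧ q'' = q') ∧ q ≤ q'') ↔ q ≤ q' by simp]
      · clear ih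
        have hd' : ∀ c q'', (p, a, c, q'') ≠ (p', a', c', q') := by
          rintro c q'' h
          simp only [Prod.mk.injEq] at h
          exact hd ⟨h.1.symm, h.2.1.symm⟩
        simp only [hd, if_false, List.mem_cons, hd', false_or]
  rw [maxTarget, h]
  simp

theorem mem_initialRecord_iff {I : List ℕ} {x : ℕ} :
    x ∈ initialRecord I ↔ ∃ q ∈ I, x ≤ q := by
  have h : ∀ y, x < I.foldl (fun x q => max x (q + 1)) y ↔ x < y ∨ ∃ q ∈ I, x ≤ q := by
    induction I with
    | nil => simp
    | cons q I ih =>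
      intro y
      rw [List.foldl_cons, ih]
      simp only [List.mem_cons, lt_max_iff, Nat.lt_succ_iff, or_and_right, exists_or,
        exists_eq_left, or_assoc]
  simp [initialRecord, h]

theorem isRecordList_initialRecord {n : ℕ} {I : List ℕ} (hI : ∀ q ∈ I, q < n) :
    IsRecordList n (initialRecord I) := by
  have h := fun x => mem_initialRecord_iff (I := I) (x := x)
  rw [initialRecord] at h ⊢
  rcases hs : I.foldl (fun x q => max x (q + 1)) 0 with _ | s
  · exact Or.inl rfl
  · rw [hs] at h
    right
    refine ⟨s, ?_, (List.range s).reverse, by simp [List.range_succ], List.reverse_perm _⟩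
    obtain ⟨q, hq, hle⟩ := (h s).mp (by simp)
    exact hle.trans_lt (hI q hq)

end AutCode

/-! ### Records and their codes -/

section RecordCode

variable {Q : Type*} [LinearOrder Q] {n : ℕ}

/-- The list of the numbers of the entries of a record. -/
def Record.code (e : Q ≃o Fin n) (s : Record Q) : List ℕ :=
  s.toList.map fun q => (e q : ℕ)

theorem val_orderIso_injective (e : Q ≃o Fin n) : Function.Injective fun q => (e q : ℕ) :=
  Fin.val_injective.comp e.injective

theorem val_orderIso_symm (e : Q ≃o Fin n) {x : ℕ} (hx : x < n) :
    (e (e.symm ⟨x, hx⟩) : ℕ) = x := by simp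

theorem Record.mem_code_iff (e : Q ≃o Fin n) {s : Record Q} {q : Q} :
    (e q : ℕ) ∈ s.code e ↔ q ∈ s.toList :=
  List.mem_map_of_injective (val_orderIso_injective e)

theorem Record.code_injective (e : Q ≃o Fin n) : Function.Injective (Record.code e) := by
  rintro ⟨r, _, _, _⟩ ⟨r', _, _, _⟩ h
  obtain rfl : r = r' := List.map_injective_iff.mpr (val_orderIso_injective e) h
  rfl

/-- The entries are exactly the states up to the first one `a`, so the tail lists the numbers below
`e a` without repetition. -/
theorem Record.isRecordList_code (e : Q ≃o Fin n) (s : Record Q) : IsRecordList n (s.code e) := by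
  have hnd : (s.code e).Nodup := s.nodup.map (val_orderIso_injective e)
  have hmem := fun q => Record.mem_code_iff e (s := s) (q := q)
  have hcode : s.code e = s.toList.map fun q => (e q : ℕ) := rfl
  rcases hs : s.toList with _ | ⟨a, t⟩
  · left
    rw [hcode, hs, List.map_nil]
  · right
    rw [hs, List.map_cons] at hcode
    refine ⟨e a, (e a).2, _, hcode, ?_⟩
    rw [hcode, List.nodup_cons] at hnd
    rw [List.perm_ext_iff_of_nodup hnd.2 List.nodup_range]
    intro x
    rw [List.mem_range]
    constructor
    · intro hx
      obtain ⟨q, hq, rfl⟩ := List.mem_map.mp hx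
      have h1 : q ≤ a := s.head_max a (by simp [hs]) q (by simp [hs, hq])
      have h2 : (e q : ℕ) ≠ e a := fun h => hnd.1 (h ▸ hx)
      have h3 : (e q : ℕ) ≤ e a := e.monotone h1
      omega
    · intro hx
      have hxn : x < n := hx.trans (e a).2
      have h1 : e.symm ⟨x, hxn⟩ ≤ a := by
        rw [OrderIso.symm_apply_le]
        exact hx.le
      have h2 : e.symm ⟨x, hxn⟩ ∈ s.toList := s.lower h1 (by simp [hs])
      rw [← hmem, val_orderIso_symm, hcode, List.mem_cons] at h2
      exact h2.resolve_left hx.ne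

theorem Record.exists_code_eq (e : Q ≃o Fin n) {r : List ℕ} (hr : IsRecordList n r) :
    ∃ s : Record Q, s.code e = r := by
  have hmap : ∃ L : List Q, L.map (fun q => (e q : ℕ)) = r :=
    ⟨r.pmap (fun x hx => e.symm ⟨x, hx⟩) (fun _ => hr.lt), by simp [List.map_pmap]⟩
  obtain ⟨L, hL⟩ := hmap
  have hmem : ∀ q, (e q : ℕ) ∈ r ↔ q ∈ L := fun q => by
    rw [← hL]
    exact List.mem_map_of_injective (val_orderIso_injective e)
  have hle : ∀ a t, L = a :: t → ∀ q, q ∈ L ↔ q ≤ a := by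
    rintro a t rfl q
    rw [List.map_cons] at hL
    subst hL
    rw [← hmem, hr.mem_iff]
    exact e.le_iff_le
  refine ⟨⟨L, ?_, ?_, ?_⟩, hL⟩
  · have := hr.nodup
    rw [← hL] at this
    exact this.of_map _
  · intro q q' hq' hq
    rcases L with _ | ⟨a, t⟩
    · simp at hq
    · exact ((hle a t rfl) q').mpr (hq'.trans (((hle a t rfl) q).mp hq))
  · intro a ha q hq
    rcases L with _ | ⟨b, t⟩
    · simp at hq
    · simp only [List.head?_cons, Option.mem_def, Option.some.injEq] at ha
      exact ha ▸ (hle b t rfl q).mp hq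

/-- The numbering of the records by their indices in `recordLists n`. -/
noncomputable def recordEquiv (e : Q ≃o Fin n) :
    (Set.univ : Set (Record Q)) ≃ Fin (recordLists n).length :=
  Equiv.ofBijective
    (fun s => ⟨(recordLists n).idxOf (s.1.code e),
      List.idxOf_lt_length_iff.mpr (mem_recordLists.mpr (s.1.isRecordList_code e))⟩) <| by
    constructor
    · intro s s' h
      have h' := Fin.val_eq_of_eq h
      have hs := mem_recordLists.mpr (s.1.isRecordList_code e)
      exact Subtype.ext (Record.code_injective e ((List.idxOf_inj hs).mp h'))
    · intro j
      obtain ⟨s, hs⟩ := Record.exists_code_eq e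
        (mem_recordLists.mp ((recordLists n).getElem_mem j.2))
      refine ⟨⟨s, trivial⟩, Fin.ext ?_⟩
      simp only [hs]
      exact (nodup_recordLists n).idxOf_getElem _ _

theorem recordEquiv_apply (e : Q ≃o Fin n) (s : (Set.univ : Set (Record Q))) :
    (recordEquiv e s : ℕ) = (recordLists n).idxOf (s.1.code e) := rfl

end RecordCode

/-! ### Transfer from descriptions to automata -/

namespace AutCode

section Determinize

variable {Q : Type*} [LinearOrder Q] {A : OrderedBuchi Q} {m n : ℕ} {l : A.tiles ≃ Fin m}
  {e : Q ≃o Fin n} {C : AutCode}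

theorem Describes.mem_trans_iff (hC : C.Describes A.toParity l e.toEquiv) {p q : Q} {a : A.tiles}
    {c : Fin 2} : ((e p : ℕ), (l a : ℕ), (c : ℕ), (e q : ℕ)) ∈ C.trans ↔ (p, c, q) ∈ (a : Tile Q) := by
  obtain ⟨-, -, -, -, -, h⟩ := hC
  rw [h]
  constructor
  · rintro ⟨⟨p', a', c', q'⟩, ⟨c'', hc, hd⟩, he⟩
    simp only [Prod.mk.injEq, Fin.val_inj] at he hc
    obtain ⟨h1, h2, h3, h4⟩ := he
    obtain rfl := e.injective h1
    obtain rfl := l.injective h2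
    obtain rfl := e.injective h4
    obtain rfl : c = c'' := Fin.ext (h3.trans hc)
    exact hd
  · intro h
    exact ⟨(p, a, (c : ℕ), q), ⟨c, rfl, h⟩, rfl⟩

theorem Describes.exists_of_mem_trans (hC : C.Describes A.toParity l e.toEquiv) {p : Q}
    {a : A.tiles} {c q : ℕ} (h : ((e p : ℕ), (l a : ℕ), c, q) ∈ C.trans) :
    ∃ (c' : Fin 2) (q' : Q), c = c' ∧ q = e q' ∧ (p, c', q') ∈ (a : Tile Q) := by
  have h' := h
  obtain ⟨-, -, -, -, -, h1⟩ := hC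
  rw [h1] at h'
  obtain ⟨⟨p', a', c', q'⟩, ⟨c'', hc, hd⟩, he⟩ := h'
  simp only [Prod.mk.injEq, Fin.val_inj] at he hc
  obtain ⟨h2, h3, h4, h5⟩ := he
  obtain rfl := e.injective h2
  obtain rfl := l.injective h3
  exact ⟨c'', q', h4.trans hc, h5, hd⟩

/-- Lowering the target strictly goes up in the order on transitions, whatever the priority; so the
targets of a state are downwards closed. -/
theorem Describes.lt_maxTarget_iff (hC : C.Describes A.toParity l e.toEquiv) {p q : Q}
    {a : A.tiles} :
    (e q : ℕ) < maxTarget C.trans (l a) (e p) ↔ ∃ c, (p, c, q) ∈ (a : Tile Q) := by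
  rw [AutCode.lt_maxTarget_iff]
  constructor
  · rintro ⟨c, x, h, hle⟩
    obtain ⟨c', q', rfl, rfl, hd⟩ := hC.exists_of_mem_trans h
    have hq : q ≤ q' := e.le_iff_le.mp hle
    rcases hq.eq_or_lt with rfl | hq
    · exact ⟨c', hd⟩
    · refine ⟨0, A.tiles_upClosed _ a.2 (p, c', q') _ ⟨le_rfl, hq.le, fun h => ?_⟩ hd⟩
      exact absurd (Prod.mk.inj h).2 hq.ne'
  · rintro ⟨c, h⟩
    exact ⟨c, e q, hC.mem_trans_iff.mpr h, le_rfl⟩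

theorem Describes.maxTarget_le (hC : C.Describes A.toParity l e.toEquiv) (p : Q)
    (a : A.tiles) : maxTarget C.trans (l a) (e p) ≤ n := by
  by_contra hlt
  obtain ⟨c, x, h, hle⟩ := AutCode.lt_maxTarget_iff.mp (not_le.mp hlt)
  obtain ⟨c', q', rfl, rfl, hd⟩ := hC.exists_of_mem_trans h
  have := (e q').2
  omega

/-- If `q` is not the largest target, its successor is a target as well, and upward closure gives
the Büchi transition to `q`. -/
theorem Describes.mem_buchi_iff (hC : C.Describes A.toParity l e.toEquiv) {p q : Q}
    {a : A.tiles} :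
    (p, 0, q) ∈ (a : Tile Q) ↔ (e q : ℕ) + 1 < maxTarget C.trans (l a) (e p) ∨
      ((e q : ℕ) + 1 = maxTarget C.trans (l a) (e p) ∧ isBuchi C.trans (l a) (e p)) := by
  have hg : (e q : ℕ) + 1 = maxTarget C.trans (l a) (e p) →
      (isBuchi C.trans (l a) (e p) ↔ (p, 0, q) ∈ (a : Tile Q)) := by
    intro h
    rw [← hC.mem_trans_iff, isBuchi, decide_eq_true_iff, ← h]
    rfl
  constructor
  · intro h
    have h1 := hC.lt_maxTarget_iff.mpr ⟨0, h⟩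
    rcases (Nat.succ_le_of_lt h1).eq_or_lt with h2 | h2
    · exact Or.inr ⟨h2, (hg h2).mpr h⟩
    · exact Or.inl h2
  · rintro (h | ⟨h, h'⟩)
    · have hle := hC.maxTarget_le p a
      have hx : (e q : ℕ) + 1 < n := by omega
      rw [← val_orderIso_symm e hx, hC.lt_maxTarget_iff] at h
      obtain ⟨c, hc⟩ := h
      have hlt : q < e.symm ⟨_, hx⟩ := by
        rw [← e.lt_iff_lt, e.apply_symm_apply, Fin.lt_def]
        exact Nat.lt_succ_self _
      exact A.tiles_upClosed _ a.2 (p, c, e.symm ⟨_, hx⟩) _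
        ⟨le_rfl, hlt.le, fun h => absurd (Prod.mk.inj h).2 hlt.ne'⟩ hc
    · exact (hg h).mp h'

theorem Describes.isTileMap (hC : C.Describes A.toParity l e.toEquiv) (a : A.tiles) :
    IsTileMap n (maxTarget C.trans (l a)) (isBuchi C.trans (l a)) := by
  have hle : ∀ p < n, maxTarget C.trans (l a) p ≤ n := fun p hp => by
    have := hC.maxTarget_le (e.symm ⟨p, hp⟩) a
    rwa [val_orderIso_symm] at this
  -- Raising the source strictly also goes up regardless of priority: a larger state has Büchi
  -- transitions to all targets of a smaller one. This gives both monotonicity and `strict`.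
  have hbuchi : ∀ p p' : Q, p < p' → ∀ q : Q,
      (e q : ℕ) < maxTarget C.trans (l a) (e p) → (p', 0, q) ∈ (a : Tile Q) := by
    intro p p' hlt q hq
    obtain ⟨c, hc⟩ := hC.lt_maxTarget_iff.mp hq
    exact A.tiles_upClosed _ a.2 (p, c, q) _
      ⟨hlt.le, le_rfl, fun h => absurd (Prod.mk.inj h).1 hlt.ne⟩ hc
  have hlt : ∀ p p' (hp : p < n) (hp' : p' < n), p < p' → ∀ x < maxTarget C.trans (l a) p,
      ∃ hx : x < n, (e.symm ⟨p', hp'⟩, 0, e.symm ⟨x, hx⟩) ∈ (a : Tile Q) := by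
    intro p p' hp hp' hpp x hx
    have hxn : x < n := hx.trans_le (hle p hp)
    refine ⟨hxn, hbuchi (e.symm ⟨p, hp⟩) _ ?_ _ ?_⟩
    · rw [e.symm.lt_iff_lt]
      exact hpp
    · rwa [val_orderIso_symm, val_orderIso_symm]
  refine ⟨?_, hle, ?_⟩
  · intro p p' hpp hp'
    rcases hpp.eq_or_lt with rfl | hpp
    · exact le_rfl
    · by_contra hf
      obtain ⟨hx, h⟩ := hlt p p' (hpp.trans hp') hp' hpp _ (not_le.mp hf)
      have := hC.lt_maxTarget_iff.mpr ⟨0, h⟩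
      simp only [val_orderIso_symm] at this
      exact this.false
  · intro p p' hpp hp' hf h0
    obtain ⟨hx, h⟩ := hlt p p' (hpp.trans hp') hp' hpp (maxTarget C.trans (l a) p' - 1) (by omega)
    rw [hC.mem_buchi_iff] at h
    simp only [val_orderIso_symm] at h
    rcases h with h | h
    · omega
    · exact h.2

theorem Describes.initial_iff (hC : C.Describes A.toParity l e.toEquiv) {q : Q} :
    (e q : ℕ) ∈ initialRecord C.initial ↔ q ∈ A.initial := by
  obtain ⟨-, -, -, -, h, -⟩ := hC
  rw [mem_initialRecord_iff]
  constructor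
  · rintro ⟨x, hx, hle⟩
    obtain ⟨q', hq', rfl⟩ := (h x).mp hx
    exact A.initial_lower (e.le_iff_le.mp hle) hq'
  · intro hq
    exact ⟨_, (h _).mpr ⟨q, hq, rfl⟩, le_rfl⟩

theorem Describes.isRecordList_initialRecord (hC : C.Describes A.toParity l e.toEquiv) :
    IsRecordList n (initialRecord C.initial) := by
  obtain ⟨-, -, -, -, h, -⟩ := hC
  refine AutCode.isRecordList_initialRecord fun x hx => ?_
  obtain ⟨q, -, rfl⟩ := (h x).mp hx
  exact (e q).2

theorem Describes.stepSpec (hC : C.Describes A.toParity l e.toEquiv) (a : A.tiles) {r : List ℕ}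
    (hr : IsRecordList n r) :
    StepSpec (maxTarget C.trans (l a)) (isBuchi C.trans (l a)) n r (C.recordTrans (l a) r).1
      (C.recordTrans (l a) r).2 := by
  rw [recordTrans, hC.2.1]
  exact recordStep_spec (hC.isTileMap a) hr

/-- Acceptance of the ordered Büchi automaton in terms of numbered states. -/
theorem Describes.mem_language_iff (hC : C.Describes A.toParity l e.toEquiv) (w : ℕ → A.tiles) :
    w ∈ A.toParity.language ↔ ∃ ρ, IsBuchiRun (fun i => maxTarget C.trans (l (w i)))
      (fun i => isBuchi C.trans (l (w i))) (initialRecord C.initial) ρ := by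
  constructor
  · rintro ⟨q, c, h0, hstep, hacc⟩
    choose b hb hmem using hstep
    simp only at hb hmem
    have hc : ∀ i, c i ≤ 1 := fun i => by
      have := (b i).2
      have := hb i
      omega
    rw [parityAccepting_iff_frequently_eq_zero hc] at hacc
    refine ⟨fun i => e (q i), hC.initial_iff.mpr h0,
      fun i => hC.lt_maxTarget_iff.mpr ⟨b i, hmem i⟩, hacc.mono fun i hi => ?_⟩
    have hbi : b i = 0 := Fin.ext (by rw [← hb i, hi]; rfl)
    have := hmem i
    rw [hbi] at this
    exact hC.mem_buchi_iff.mp this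
  · rintro ⟨ρ, h0, hstep, hacc⟩
    have hn : ∀ i, ρ i < n := by
      intro i
      induction i with
      | zero => exact hC.isRecordList_initialRecord.lt h0
      | succ i ih => exact (hstep i).trans_le ((hC.isTileMap (w i)).le _ ih)
    obtain ⟨q, rfl⟩ : ∃ q : ℕ → Q, ρ = fun i => (e (q i) : ℕ) :=
      ⟨fun i => e.symm ⟨ρ i, hn i⟩, funext fun i => (val_orderIso_symm e (hn i)).symm⟩
    -- A tile may allow both priorities between two states; the run takes `0` whenever possible.
    have hc : ∀ i, ∃ c : Fin 2, (q i, c, q (i + 1)) ∈ (w i : Tile Q) ∧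
        ((q i, 0, q (i + 1)) ∈ (w i : Tile Q) → c = 0) := by
      intro i
      by_cases hz : (q i, 0, q (i + 1)) ∈ (w i : Tile Q)
      · exact ⟨0, hz, fun _ => rfl⟩
      · obtain ⟨c, hc⟩ := hC.lt_maxTarget_iff.mp (hstep i)
        exact ⟨c, hc, fun h => absurd h hz⟩
    choose c hc hc0 using hc
    refine ⟨q, fun i => c i, hC.initial_iff.mp h0, fun i => ⟨c i, rfl, hc i⟩, ?_⟩
    rw [parityAccepting_iff_frequently_eq_zero fun i => by have := (c i).2; omega]
    refine hacc.mono fun i hi => ?_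
    rw [hc0 i (hC.mem_buchi_iff.mpr hi)]
    rfl

/-- The deterministic automaton described by `C.determinize`. -/
def Describes.recordAutomaton (hC : C.Describes A.toParity l e.toEquiv) :
    ParityAutomaton A.tiles (Set.univ : Set (Record Q)) where
  lo := 0
  hi := 2 * n + 1
  lo_le_hi := Nat.zero_le _
  initial := {s | s.1.code e = initialRecord C.initial}
  trans := {d | C.recordTrans (l d.2.1) (d.1.1.code e) = (d.2.2.2.1.code e, d.2.2.1)}
  priority_mem := by
    rintro ⟨s, a, c, s'⟩ h
    have h1 := (hC.stepSpec a (s.1.isRecordList_code e)).prio_le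
    rw [Set.mem_ofPred_eq] at h
    rw [h] at h1
    exact ⟨Nat.zero_le _, h1⟩

theorem Describes.determinize_describes (hC : C.Describes A.toParity l e.toEquiv) :
    C.determinize.Describes hC.recordAutomaton l (recordEquiv e) := by
  have hm := hC.1
  have hn := hC.2.1
  refine ⟨hm, by rw [determinize, hn], rfl, by rw [determinize, hn]; rfl, ?_, ?_⟩
  · intro x
    simp only [determinize, hn, List.mem_singleton]
    constructor
    · rintro rfl
      obtain ⟨s, hs⟩ := Record.exists_code_eq e hC.isRecordList_initialRecord
      exact ⟨⟨s, trivial⟩, hs, by rw [recordEquiv_apply, hs]⟩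
    · rintro ⟨s, hs, rfl⟩
      rw [recordEquiv_apply]
      congr 1
  · intro x
    simp only [determinize, hn, hm, List.mem_flatMap, List.mem_map, List.mem_range,
      mem_recordLists]
    constructor
    · rintro ⟨r, hr, a, ha, rfl⟩
      obtain ⟨a, rfl⟩ : ∃ a' : A.tiles, a = l a' := ⟨l.symm ⟨a, ha⟩, by simp⟩
      obtain ⟨s, rfl⟩ := Record.exists_code_eq e hr
      obtain ⟨s', hs'⟩ := Record.exists_code_eq e (hC.stepSpec a hr).isRecordList
      exact ⟨(⟨s, trivial⟩, a, (C.recordTrans (l a) (s.code e)).2, ⟨s', trivial⟩),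
        Prod.ext hs'.symm rfl,
        by simp only [recordEquiv_apply, hs']⟩
    · rintro ⟨⟨s, a, c, s'⟩, hd, rfl⟩
      refine ⟨s.1.code e, s.1.isRecordList_code e, l a, (l a).2, ?_⟩
      have hd' : C.recordTrans (l a) (s.1.code e) = (s'.1.code e, c) := hd
      simp only [hd', recordEquiv_apply]

theorem Describes.recordAutomaton_isDeterministic (hC : C.Describes A.toParity l e.toEquiv) :
    hC.recordAutomaton.IsDeterministic := by
  constructor
  · obtain ⟨s, hs⟩ := Record.exists_code_eq e hC.isRecordList_initialRecord
    refine ⟨⟨s, trivial⟩, Set.eq_singleton_iff_unique_mem.mpr ⟨hs, fun s' hs' => ?_⟩⟩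
    exact Subtype.ext (Record.code_injective e (Eq.trans hs' hs.symm))
  · intro s a
    obtain ⟨s', hs'⟩ := Record.exists_code_eq e
      (hC.stepSpec a (s.1.isRecordList_code e)).isRecordList
    refine ⟨((C.recordTrans (l a) (s.1.code e)).2, ⟨s', trivial⟩), Prod.ext hs'.symm rfl, ?_⟩
    rintro ⟨c, s''⟩ h
    have h' : C.recordTrans (l a) (s.1.code e) = (s''.1.code e, c) := h
    rw [h'] at hs'
    rw [h']
    exact Prod.ext rfl (Subtype.ext (Record.code_injective e hs'.symm))

theorem Describes.recordAutomaton_language (hC : C.Describes A.toParity l e.toEquiv) :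
    hC.recordAutomaton.language = A.toParity.language := by
  ext w
  -- This covers every run over `w`, accepting or not; existence of a run, by determinism, then
  -- gives the inclusion from right to left.
  have key : ∀ (s : ℕ → (Set.univ : Set (Record Q))) (c : ℕ → ℕ),
      s 0 ∈ hC.recordAutomaton.initial →
      (∀ i, (s i, w i, c i, s (i + 1)) ∈ hC.recordAutomaton.trans) →
      (ParityAccepting c ↔ w ∈ A.toParity.language) := by
    intro s c h0 hstep
    have h0' : (s 0).1.code e = initialRecord C.initial := h0
    have hrun : IsRecordRun n (fun i => maxTarget C.trans (l (w i)))
        (fun i => isBuchi C.trans (l (w i))) (fun i => (s i).1.code e) c := by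
      refine ⟨fun i => hC.isTileMap (w i), fun i => (s i).1.isRecordList_code e, fun i => ?_⟩
      have h1 : C.recordTrans (l (w i)) ((s i).1.code e) = ((s (i + 1)).1.code e, c i) := hstep i
      have h2 := hC.stepSpec (w i) ((s i).1.isRecordList_code e)
      rwa [h1] at h2
    rw [hC.mem_language_iff, hrun.parityAccepting_iff, h0']
  constructor
  · rintro ⟨s, c, h0, hstep, hacc⟩
    exact (key s c h0 hstep).mp hacc
  · intro hw
    obtain ⟨s, c, h0, hstep⟩ := hC.recordAutomaton_isDeterministic.exists_run w
    exact ⟨s, c, h0, hstep, (key s c h0 hstep).mpr hw⟩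

theorem Describes.recordAutomaton_reach (hC : C.Describes A.toParity l e.toEquiv)
    (u : List A.tiles) (s : (Set.univ : Set (Record Q))) (hs : s ∈ hC.recordAutomaton.reach u) :
    {q | q ∈ s.1.toList} = A.toParity.reach u := by
  induction u using List.reverseRecOn generalizing s with
  | nil =>
    ext q
    have hs' : s.1.code e = initialRecord C.initial := hs
    rw [Set.mem_ofPred_eq, ← Record.mem_code_iff e, hs', hC.initial_iff]
    rfl
  | append_singleton u a ih =>
    rw [ParityAutomaton.reach_append_singleton] at hs ⊢
    obtain ⟨s₀, hs₀, c, hstep⟩ := hs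
    rw [← ih s₀ hs₀]
    have h1 : C.recordTrans (l a) (s₀.1.code e) = (s.1.code e, c) := hstep
    have h2 := hC.stepSpec a (s₀.1.isRecordList_code e)
    rw [h1] at h2
    ext q
    rw [Set.mem_ofPred_eq, ← Record.mem_code_iff e, h2.mem_iff]
    constructor
    · rintro ⟨x, hx, hq⟩
      obtain ⟨p, hp, rfl⟩ := List.mem_map.mp hx
      obtain ⟨c, hc⟩ := hC.lt_maxTarget_iff.mp hq
      exact ⟨p, hp, c, c, rfl, hc⟩
    · rintro ⟨p, hp, _, c, -, hc⟩
      exact ⟨e p, (Record.mem_code_iff e).mpr hp, hC.lt_maxTarget_iff.mpr ⟨c, hc⟩⟩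

end Determinize

end AutCode

theorem mainTheorem3 :
    ∃ F : AutCode → AutCode, Computable F ∧
      ∀ (Q : Type*) [Finite Q] [LinearOrder Q] (A : OrderedBuchi Q) (m n : ℕ)
        (l : A.tiles ≃ Fin m) (e : Q ≃o Fin n) (C : AutCode),
        C.Describes A.toParity l e.toEquiv →
        ∃ (S : Set (Record Q)) (D : ParityAutomaton A.tiles S) (k : ℕ) (σ : S ≃ Fin k),
          (F C).Describes D l σ ∧
          D.IsDeterministic ∧
          D.language = A.toParity.language ∧
          k ≤ 1 + ∑ i ∈ Finset.range (Nat.card Q), Nat.factorial i ∧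
          (∀ (u : List A.tiles) (s : S), s ∈ D.reach u →
            {q | q ∈ s.1.toList} = A.toParity.reach u) := by
  refine ⟨AutCode.determinize, AutCode.primrec_determinize.to_comp, ?_⟩
  intro Q _ _ A m n l e C hC
  refine ⟨Set.univ, hC.recordAutomaton, _, recordEquiv e, hC.determinize_describes,
    hC.recordAutomaton_isDeterministic, hC.recordAutomaton_language, ?_,
    hC.recordAutomaton_reach⟩
  rw [length_recordLists, Nat.card_congr e.toEquiv, Nat.card_fin]
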